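/- For a unital C*-algebra $A$ and $m\ge 1$, let $Lg_m(A)$ be the set of vectors $(a_1,\dots,a_m)\in A^m$ with $Aa_1+\cdots+Aa_m=A$, let $GL_m(A)$ be the group of invertible $m\times m$ matrices over $A$, acting on $Lg_m(A)$ by left multiplication, and let $GL_m^0(A)$ be the connected component of the identity in $GL_m(A)$. The general stable rank $\mathrm{gsr}(A)$ (respectively, the connected stable rank $\mathrm{csr}(A)$) is the least integer $n\ge 1$ such that $GL_m(A)$ (respectively, $GL_m^0(A)$) acts transitively on $Lg_m(A)$ for all $m\ge n$, and $+\infty$ if there is no such $n$. Let $X$ and $Y$ be compact Hausdorff spaces with base points $x_0\in X$ and $y_0\in Y$, and let $X\vee Y$ be their wedge sum, that is, the quotient of the disjoint union $X\sqcup Y$ obtained by identifying $x_0$ with $y_0$. Write $C(Z)$ for the C*-algebra of continuous complex-valued functions on a compact Hausdorff space $Z$. Then $$\mathrm{gsr}(C(X\vee Y))=\max\{\mathrm{gsr}(C(X)),\mathrm{gsr}(C(Y))\}$$ and $$\mathrm{csr}(C(X\vee Y))=\max\{\mathrm{csr}(C(X)),\mathrm{csr}(C(Y))\}.$$ -/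

import Mathlib

/-- The set `Lg_n(A)` of left unimodular vectors: those `a ∈ Aⁿ` with `A a₁ + ⋯ + A aₙ = A`.
(`Ideal A` is the type of left ideals of `A`.) -/
def leftUnimodular (A : Type*) [Ring A] (n : ℕ) : Set (Fin n → A) :=
  {a | Ideal.span (Set.range a) = ⊤}

/-- `a` is left unimodular iff `∑ bᵢ aᵢ = 1` for some vector `b`. -/
theorem mem_leftUnimodular_iff {A : Type*} [Ring A] {n : ℕ} {a : Fin n → A} :
    a ∈ leftUnimodular A n ↔ ∃ b : Fin n → A, ∑ i, b i * a i = 1 := by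
  rw [leftUnimodular, Set.mem_ofPred_eq, Ideal.eq_top_iff_one, Ideal.span]
  exact Submodule.mem_span_range_iff_exists_fun A

/-- A set `G` of invertible `n × n` matrices over `A` (below: a subgroup of `GL_n(A)`) acts
transitively, by left multiplication, on the left unimodular vectors in `Aⁿ`. -/
def ActsTransitivelyOnLg (A : Type*) [Ring A] (n : ℕ) (G : Set (GL (Fin n) A)) : Prop :=
  ∀ a ∈ leftUnimodular A n, ∀ b ∈ leftUnimodular A n,
    ∃ T ∈ G, (T : Matrix (Fin n) (Fin n) A).mulVec a = b

/-- The general stable rank: the least `n ≥ 1` such that `GL_m(A)` acts transitively on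
`Lg_m(A)` for all `m ≥ n`, and `⊤` if there is no such `n`. -/
noncomputable def gsr (A : Type*) [Ring A] : ℕ∞ :=
  sInf {k : ℕ∞ | ∃ n : ℕ, k = n ∧ 1 ≤ n ∧
    ∀ m : ℕ, n ≤ m → ActsTransitivelyOnLg A m Set.univ}

/-- The connected stable rank: the least `n ≥ 1` such that `GL_m⁰(A)`, the connected component
of the identity in `GL_m(A)`, acts transitively on `Lg_m(A)` for all `m ≥ n`, and `⊤` if there is
no such `n`. -/
noncomputable def csr (A : Type*) [Ring A] [TopologicalSpace A] : ℕ∞ :=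
  sInf {k : ℕ∞ | ∃ n : ℕ, k = n ∧ 1 ≤ n ∧
    ∀ m : ℕ, n ≤ m → ActsTransitivelyOnLg A m (connectedComponent (1 : GL (Fin m) A))}

/-- The wedge sum `X ∨ Y` of `(X, x₀)` and `(Y, y₀)`: the quotient of the disjoint union `X ⊔ Y`
by the equivalence relation generated by `x₀ ∼ y₀`. -/
def WedgeSum {X Y : Type*} (x₀ : X) (y₀ : Y) : Type _ :=
  Quot (fun a b : X ⊕ Y => a = Sum.inl x₀ ∧ b = Sum.inr y₀)

/-- The quotient topology on the wedge sum. -/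
instance WedgeSum.instTopologicalSpace {X Y : Type*} [TopologicalSpace X] [TopologicalSpace Y]
    (x₀ : X) (y₀ : Y) : TopologicalSpace (WedgeSum x₀ y₀) :=
  inferInstanceAs
    (TopologicalSpace (Quot (fun a b : X ⊕ Y => a = Sum.inl x₀ ∧ b = Sum.inr y₀)))

instance WedgeSum.instCompactSpace {X Y : Type*} [TopologicalSpace X] [TopologicalSpace Y]
    [CompactSpace X] [CompactSpace Y] (x₀ : X) (y₀ : Y) : CompactSpace (WedgeSum x₀ y₀) :=
  inferInstanceAs
    (CompactSpace (Quot (fun a b : X ⊕ Y => a = Sum.inl x₀ ∧ b = Sum.inr y₀)))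

section MatrixActions

open Matrix

variable {R S : Type*} [CommRing R] [CommRing S] {n : ℕ}

/-! `C(X ∨ Y)` is the fibre product of `C(X)` and `C(Y)` over the functions on a point, and all the
maps split. In each size, transitivity over `C(X ∨ Y)` is equivalent to transitivity over both
factors: it descends because the factors are retracts. Conversely, matrices solving the problem on
`X` and `Y` may disagree at the base point, but their discrepancy there fixes the common value of
the vector. It lifts to a stabilizer over `X`, and the corrected matrices glue. Continuous
homomorphisms preserve identity components, so one argument serves both ranks. -/

theorem comp_mem_leftUnimodular (f : R →+* S) {a : Fin n → R} (ha : a ∈ leftUnimodular R n) :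
    f ∘ a ∈ leftUnimodular S n := by
  obtain ⟨b, hb⟩ := mem_leftUnimodular_iff.1 ha
  refine mem_leftUnimodular_iff.2 ⟨f ∘ b, ?_⟩
  simpa using congrArg f hb

theorem GL_map_mulVec (f : R →+* S) (T : GL (Fin n) R) (a : Fin n → R) :
    (GeneralLinearGroup.map f T : Matrix (Fin n) (Fin n) S) *ᵥ (f ∘ a) =
      f ∘ ((T : Matrix (Fin n) (Fin n) R) *ᵥ a) := by
  ext i
  exact (RingHom.map_mulVec f T.val a i).symm

theorem GL_map_map {R' : Type*} [CommRing R'] (f : S →+* R') (g : R →+* S) (T : GL (Fin n) R) :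
    GeneralLinearGroup.map f (GeneralLinearGroup.map g T) = GeneralLinearGroup.map (f.comp g) T :=
  rfl

theorem GL_mul_mulVec (T U : GL (Fin n) R) (a : Fin n → R) :
    ((T * U : GL (Fin n) R) : Matrix (Fin n) (Fin n) R) *ᵥ a = T.val *ᵥ (U.val *ᵥ a) := by
  simp

theorem GL_inv_mulVec_eq_iff {T : GL (Fin n) R} {a b : Fin n → R} :
    (T⁻¹ : GL (Fin n) R).val *ᵥ b = a ↔ T.val *ᵥ a = b := by
  constructor <;> rintro rfl <;> rw [← GL_mul_mulVec] <;> simp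

/-- Transitivity passes to retracts. -/
theorem ActsTransitivelyOnLg.of_retract (p : R →+* S) (s : S →+* R)
    (hps : p.comp s = RingHom.id S) {G : Set (GL (Fin n) R)} {H : Set (GL (Fin n) S)}
    (hp : ∀ T ∈ G, GeneralLinearGroup.map p T ∈ H) (h : ActsTransitivelyOnLg R n G) :
    ActsTransitivelyOnLg S n H := by
  intro a ha b hb
  obtain ⟨T, hT, hTab⟩ := h _ (comp_mem_leftUnimodular s ha) _ (comp_mem_leftUnimodular s hb)
  have hcomp (c : Fin n → S) : p ∘ (s ∘ c) = c := funext fun i => RingHom.congr_fun hps (c i)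
  refine ⟨_, hp T hT, ?_⟩
  have := GL_map_mulVec p T (s ∘ a)
  rwa [hTab, hcomp, hcomp] at this

/-- If `R` acts transitively and `ε : R → S` is split by `c`, then an element of the group over `S`
stabilizing `ε a` lifts to an element stabilizing `a`. -/
theorem ActsTransitivelyOnLg.exists_stabilizer_lift {ε : R →+* S} {c : S →+* R}
    (hεc : ε.comp c = RingHom.id S) {G : Subgroup (GL (Fin n) R)} {H : Subgroup (GL (Fin n) S)}
    (hε : G ≤ H.comap (GeneralLinearGroup.map ε)) (hc : H ≤ G.comap (GeneralLinearGroup.map c))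
    (h : ActsTransitivelyOnLg R n (G : Set (GL (Fin n) R))) {a : Fin n → R}
    (ha : a ∈ leftUnimodular R n) {V : GL (Fin n) S} (hV : V ∈ H)
    (hVa : V.val *ᵥ (ε ∘ a) = ε ∘ a) :
    ∃ W ∈ G, W.val *ᵥ a = a ∧ GeneralLinearGroup.map ε W = V := by
  have hcomp (v : Fin n → S) : ε ∘ (c ∘ v) = v := funext fun i => RingHom.congr_fun hεc (v i)
  have hmap (P : GL (Fin n) S) :
      GeneralLinearGroup.map ε (GeneralLinearGroup.map c P) = P := by
    rw [GL_map_map, hεc]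
    simp
  obtain ⟨U, hU, hUa⟩ :=
    h _ (comp_mem_leftUnimodular c (comp_mem_leftUnimodular ε ha)) a ha
  have hUε : (GeneralLinearGroup.map ε U).val *ᵥ (ε ∘ a) = ε ∘ a := by
    have := GL_map_mulVec ε U (c ∘ (ε ∘ a))
    rwa [hUa, hcomp] at this
  set U₀ := GeneralLinearGroup.map c (GeneralLinearGroup.map ε U) with hU₀
  have hU₀G : U₀ ∈ G := hc (hε hU)
  have hU₀a : U₀.val *ᵥ (c ∘ (ε ∘ a)) = c ∘ (ε ∘ a) := by rw [hU₀, GL_map_mulVec, hUε]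
  -- Dividing out the constant part of `U` makes `N` trivial over `S`, while it still carries the
  -- constant vector to `a`. Conjugation by `N` thus turns the constant lift of `V` into a
  -- stabilizer of `a` with unchanged image.
  set N := U * U₀⁻¹ with hN
  have hNa : N.val *ᵥ (c ∘ (ε ∘ a)) = a := by
    rw [hN, GL_mul_mulVec, GL_inv_mulVec_eq_iff.2 hU₀a, hUa]
  have hNG : N ∈ G := G.mul_mem hU (G.inv_mem hU₀G)
  have hN1 : GeneralLinearGroup.map ε N = 1 := by
    rw [hN, map_mul, map_inv, hU₀, hmap, mul_inv_cancel]
  refine ⟨N * GeneralLinearGroup.map c V * N⁻¹,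
    G.mul_mem (G.mul_mem hNG (hc hV)) (G.inv_mem hNG), ?_, ?_⟩
  · rw [GL_mul_mulVec, GL_mul_mulVec, GL_inv_mulVec_eq_iff.2 hNa, GL_map_mulVec, hVa, hNa]
  · rw [map_mul, map_mul, map_inv, hN1, hmap]
    simp

/-- Transitivity over a fibre product `R = A ×_K B`, where the projections `p`, `q` and the
augmentations `ε`, `δ` are compatibly split. -/
theorem ActsTransitivelyOnLg.of_fibreProduct {A B K : Type*} [CommRing A] [CommRing B] [CommRing K]
    {p : R →+* A} {q : R →+* B} {s : A →+* R} {t : B →+* R} {ε : A →+* K} {δ : B →+* K}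
    {c : K →+* A} {d : K →+* B}
    (hps : p.comp s = RingHom.id A) (hqt : q.comp t = RingHom.id B)
    (hqs : q.comp s = d.comp ε) (hpt : p.comp t = c.comp δ)
    (hεp : ε.comp p = δ.comp q) (hεc : ε.comp c = RingHom.id K)
    (hinj : ∀ x y, p x = p y → q x = q y → x = y)
    {G : Subgroup (GL (Fin n) R)} {GA : Subgroup (GL (Fin n) A)} {GB : Subgroup (GL (Fin n) B)}
    {GK : Subgroup (GL (Fin n) K)}
    (hs : GA ≤ G.comap (GeneralLinearGroup.map s)) (ht : GB ≤ G.comap (GeneralLinearGroup.map t))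
    (hε : GA ≤ GK.comap (GeneralLinearGroup.map ε)) (hδ : GB ≤ GK.comap (GeneralLinearGroup.map δ))
    (hc : GK ≤ GA.comap (GeneralLinearGroup.map c))
    (hA : ActsTransitivelyOnLg A n (GA : Set (GL (Fin n) A)))
    (hB : ActsTransitivelyOnLg B n (GB : Set (GL (Fin n) B))) :
    ActsTransitivelyOnLg R n (G : Set (GL (Fin n) R)) := by
  intro a ha b hb
  have hbase (v : Fin n → R) : ε ∘ (p ∘ v) = δ ∘ (q ∘ v) :=
    funext fun i => RingHom.congr_fun hεp (v i)
  obtain ⟨T, hT, hTab⟩ := hA _ (comp_mem_leftUnimodular p ha) _ (comp_mem_leftUnimodular p hb)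
  obtain ⟨U, hU, hUab⟩ := hB _ (comp_mem_leftUnimodular q ha) _ (comp_mem_leftUnimodular q hb)
  -- The discrepancy `ε(T)⁻¹ δ(U)` is lifted, so that `T * W` agrees with `U` over `K`.
  obtain ⟨W, hW, hWa, hWε⟩ := hA.exists_stabilizer_lift hεc hε hc (comp_mem_leftUnimodular p ha)
    (GK.mul_mem (GK.inv_mem (hε hT)) (hδ hU)) (by
      rw [GL_mul_mulVec, GL_inv_mulVec_eq_iff, GL_map_mulVec, hTab, hbase, hbase, GL_map_mulVec,
        hUab])
  set T' := T * W with hT'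
  have hT'G : T' ∈ GA := GA.mul_mem hT hW
  have hT'ab : T'.val *ᵥ (p ∘ a) = p ∘ b := by rw [hT', GL_mul_mulVec, hWa, hTab]
  have hT'ε : GeneralLinearGroup.map ε T' = GeneralLinearGroup.map δ U := by
    rw [hT', map_mul, hWε]
    group
  set P := GeneralLinearGroup.map δ U with hP
  -- Over `A` the last two factors cancel; over `B` the first two do. Gluing by a product of lifts,
  -- rather than entrywise, keeps `M` in `G`.
  set M := GeneralLinearGroup.map s T' * (GeneralLinearGroup.map s (GeneralLinearGroup.map c P))⁻¹ *
    GeneralLinearGroup.map t U with hM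
  have hpM : GeneralLinearGroup.map p M = T' := by
    rw [hM, map_mul, map_mul, map_inv, GL_map_map p t, hpt, GL_map_map p s, GL_map_map p s, hps, ← GL_map_map c δ, ← hP]
    simp
  have hqM : GeneralLinearGroup.map q M = U := by
    rw [hM, map_mul, map_mul, map_inv, GL_map_map q t, hqt, GL_map_map q s, GL_map_map q s, hqs, ← GL_map_map d ε,
      ← GL_map_map d ε, hT'ε, GL_map_map ε c, hεc]
    simp
  refine ⟨M, G.mul_mem (G.mul_mem (hs hT'G) (G.inv_mem (hs (hc (hδ hU))))) (ht hU), ?_⟩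
  ext i
  refine hinj _ _ ?_ ?_
  · have := GL_map_mulVec p M a
    rw [hpM, hT'ab] at this
    exact (congrFun this i).symm
  · have := GL_map_mulVec q M a
    rw [hqM, hUab] at this
    exact (congrFun this i).symm

/-- Supplies every compatibility hypothesis in the case of `csr`. -/
theorem connectedComponentOfOne_le_comap_GL_map [TopologicalSpace R] [IsTopologicalRing R]
    [TopologicalSpace S] [IsTopologicalRing S] (f : R →+* S) (hf : Continuous f) :
    Subgroup.connectedComponentOfOne (GL (Fin n) R) ≤
      (Subgroup.connectedComponentOfOne (GL (Fin n) S)).comap (GeneralLinearGroup.map f) := by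
  intro T hT
  have := (Continuous.generalLinearGroup_map (n := Fin n) hf).mapsTo_connectedComponent 1 hT
  rwa [map_one] at this

end MatrixActions

namespace WedgeSum

open Matrix

variable {X Y : Type*} [TopologicalSpace X] [TopologicalSpace Y] (x₀ : X) (y₀ : Y)

/-- The inclusion of the first summand. -/
def inl : C(X, WedgeSum x₀ y₀) where
  toFun x := Quot.mk _ (Sum.inl x)
  continuous_toFun := continuous_quot_mk.comp continuous_inl

/-- The inclusion of the second summand. -/
def inr : C(Y, WedgeSum x₀ y₀) where
  toFun y := Quot.mk _ (Sum.inr y)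
  continuous_toFun := continuous_quot_mk.comp continuous_inr

theorem inl_base : inl x₀ y₀ x₀ = inr x₀ y₀ y₀ := Quot.sound ⟨rfl, rfl⟩

/-- The retraction onto the first summand. -/
def fst : C(WedgeSum x₀ y₀, X) where
  toFun := Quot.lift (Sum.elim id fun _ => x₀) (by rintro _ _ ⟨rfl, rfl⟩; rfl)
  continuous_toFun := continuous_quot_lift _ (by fun_prop)

/-- The retraction onto the second summand. -/
def snd : C(WedgeSum x₀ y₀, Y) where
  toFun := Quot.lift (Sum.elim (fun _ => y₀) id) (by rintro _ _ ⟨rfl, rfl⟩; rfl)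
  continuous_toFun := continuous_quot_lift _ (by fun_prop)

/-- Pullback of functions along a continuous map. -/
noncomputable abbrev pullback {Z W : Type*} [TopologicalSpace Z] [TopologicalSpace W] (f : C(Z, W)) :
    C(W, ℂ) →+* C(Z, ℂ) :=
  (ContinuousMap.compRightAlgHom ℂ ℂ f : C(W, ℂ) →+* C(Z, ℂ))

theorem continuous_pullback {Z W : Type*} [TopologicalSpace Z] [TopologicalSpace W] (f : C(Z, W)) :
    Continuous (pullback f) :=
  ContinuousMap.compRightAlgHom_continuous ℂ ℂ f

/-- Transitivity over the wedge sum is transitivity over both summands, for groups of matrices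
compatible with the pullbacks along the maps between the spaces involved. -/
theorem actsTransitivelyOnLg_iff {n : ℕ} {G : Subgroup (GL (Fin n) C(WedgeSum x₀ y₀, ℂ))}
    {GX : Subgroup (GL (Fin n) C(X, ℂ))} {GY : Subgroup (GL (Fin n) C(Y, ℂ))}
    {GK : Subgroup (GL (Fin n) C(Unit, ℂ))}
    (hi : G ≤ GX.comap (GeneralLinearGroup.map (pullback (inl x₀ y₀))))
    (hj : G ≤ GY.comap (GeneralLinearGroup.map (pullback (inr x₀ y₀))))
    (hr : GX ≤ G.comap (GeneralLinearGroup.map (pullback (fst x₀ y₀))))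
    (hs : GY ≤ G.comap (GeneralLinearGroup.map (pullback (snd x₀ y₀))))
    (hx : GX ≤ GK.comap (GeneralLinearGroup.map (pullback (.const Unit x₀))))
    (hy : GY ≤ GK.comap (GeneralLinearGroup.map (pullback (.const Unit y₀))))
    (hc : GK ≤ GX.comap (GeneralLinearGroup.map (pullback (.const X ())))) :
    ActsTransitivelyOnLg C(WedgeSum x₀ y₀, ℂ) n (G : Set (GL (Fin n) C(WedgeSum x₀ y₀, ℂ))) ↔
      ActsTransitivelyOnLg C(X, ℂ) n (GX : Set (GL (Fin n) C(X, ℂ))) ∧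
        ActsTransitivelyOnLg C(Y, ℂ) n (GY : Set (GL (Fin n) C(Y, ℂ))) := by
  refine ⟨fun h => ⟨h.of_retract _ (pullback (fst x₀ y₀)) rfl fun T hT => hi hT,
    h.of_retract _ (pullback (snd x₀ y₀)) rfl fun T hT => hj hT⟩, fun ⟨hX, hY⟩ => ?_⟩
  -- The splitting identities are definitional; only agreement at the base point uses the gluing
  -- relation.
  refine ActsTransitivelyOnLg.of_fibreProduct (p := pullback (inl x₀ y₀))
    (q := pullback (inr x₀ y₀)) (d := pullback (.const Y ())) rfl rfl rfl rfl ?_ rfl ?_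
    hr hs hx hy hc hX hY
  · ext f u
    exact congrArg f (inl_base x₀ y₀)
  · intro f g hfX hfY
    ext z
    induction z using Quot.ind with
    | mk z =>
      cases z with
      | inl x => exact DFunLike.congr_fun hfX x
      | inr y => exact DFunLike.congr_fun hfY y

end WedgeSum

/-- The least threshold for a conjunction is the maximum of the two least thresholds. -/
theorem sInf_threshold_and (p q : ℕ → Prop) :
    sInf {k : ℕ∞ | ∃ n : ℕ, k = n ∧ 1 ≤ n ∧ ∀ m, n ≤ m → p m ∧ q m} =
      max (sInf {k : ℕ∞ | ∃ n : ℕ, k = n ∧ 1 ≤ n ∧ ∀ m, n ≤ m → p m})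
        (sInf {k : ℕ∞ | ∃ n : ℕ, k = n ∧ 1 ≤ n ∧ ∀ m, n ≤ m → q m}) := by
  apply le_antisymm
  · rcases Set.eq_empty_or_nonempty
      {k : ℕ∞ | ∃ n : ℕ, k = n ∧ 1 ≤ n ∧ ∀ m, n ≤ m → p m} with hp | hp
    -- An empty set of thresholds has infimum `⊤`.
    · simp [hp]
    rcases Set.eq_empty_or_nonempty
      {k : ℕ∞ | ∃ n : ℕ, k = n ∧ 1 ≤ n ∧ ∀ m, n ≤ m → q m} with hq | hq
    · simp [hq]
    obtain ⟨i, hi, hi1, hip⟩ := csInf_mem hp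
    obtain ⟨j, hj, -, hjq⟩ := csInf_mem hq
    rw [hi, hj]
    exact sInf_le ⟨max i j, (Nat.mono_cast.map_max).symm, hi1.trans (le_max_left _ _), fun m hm =>
      ⟨hip m ((le_max_left _ _).trans hm), hjq m ((le_max_right _ _).trans hm)⟩⟩
  · exact max_le
      (sInf_le_sInf fun _ ⟨n, hn, hn1, h⟩ => ⟨n, hn, hn1, fun m hm => (h m hm).1⟩)
      (sInf_le_sInf fun _ ⟨n, hn, hn1, h⟩ => ⟨n, hn, hn1, fun m hm => (h m hm).2⟩)

theorem mainTheorem8 {X : Type*} {Y : Type*} [TopologicalSpace X] [CompactSpace X] [T2Space X]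
    [TopologicalSpace Y] [CompactSpace Y] [T2Space Y] (x₀ : X) (y₀ : Y) :
    gsr C(WedgeSum x₀ y₀, ℂ) = max (gsr C(X, ℂ)) (gsr C(Y, ℂ)) ∧
      csr C(WedgeSum x₀ y₀, ℂ) = max (csr C(X, ℂ)) (csr C(Y, ℂ)) := by
  constructor
  · have h (n : ℕ) := WedgeSum.actsTransitivelyOnLg_iff (n := n) x₀ y₀ (G := ⊤) (GX := ⊤)
      (GY := ⊤) (GK := ⊤) le_top le_top le_top le_top le_top le_top le_top
    have h' (n : ℕ) : ActsTransitivelyOnLg C(WedgeSum x₀ y₀, ℂ) n Set.univ ↔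
        ActsTransitivelyOnLg C(X, ℂ) n Set.univ ∧ ActsTransitivelyOnLg C(Y, ℂ) n Set.univ := h n
    simp only [gsr, h']
    exact sInf_threshold_and _ _
  · have h (n : ℕ) := WedgeSum.actsTransitivelyOnLg_iff (n := n) x₀ y₀
      (connectedComponentOfOne_le_comap_GL_map _ (WedgeSum.continuous_pullback _))
      (connectedComponentOfOne_le_comap_GL_map _ (WedgeSum.continuous_pullback _))
      (connectedComponentOfOne_le_comap_GL_map _ (WedgeSum.continuous_pullback _))
      (connectedComponentOfOne_le_comap_GL_map _ (WedgeSum.continuous_pullback _))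
      (connectedComponentOfOne_le_comap_GL_map _ (WedgeSum.continuous_pullback _))
      (connectedComponentOfOne_le_comap_GL_map _ (WedgeSum.continuous_pullback _))
      (connectedComponentOfOne_le_comap_GL_map _ (WedgeSum.continuous_pullback _))
    have h' (n : ℕ) : ActsTransitivelyOnLg C(WedgeSum x₀ y₀, ℂ) n (connectedComponent 1) ↔
        ActsTransitivelyOnLg C(X, ℂ) n (connectedComponent 1) ∧
          ActsTransitivelyOnLg C(Y, ℂ) n (connectedComponent 1) := h n
    simp only [csr, h']
    exact sInf_threshold_and _ _
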